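/- Conventions. A chain is a linearly ordered set; for chains $A, C$ let $\mathrm{Emb}(A, C)$ be the set of order embeddings $A \hookrightarrow C$; a positive integer $n$ is identified with the chain $0 < 1 < \dots < n-1$. A chain $S$ is scattered if $\mathbb{Q}$ does not embed into $S$. Let $\mathcal{H}_0$ consist of the empty chain and the one-element chain, and for an ordinal $\alpha > 0$ let $\mathcal{H}_\alpha$ consist of all lexicographic sums $\sum_{i \in \mathbb{Z}} S_i$ with $S_i \in \bigcup_{\beta < \alpha} \mathcal{H}_\beta$ for all $i \in \mathbb{Z}$ (chains being considered up to order-isomorphism). By Hausdorff's theorem every countable scattered chain $S$ belongs to some $\mathcal{H}_\alpha$; the least such $\alpha$ is the Hausdorff rank $r_H(S)$. For a chain $C$ and $n \ge 1$, the big Ramsey degree $T(n, C)$ is the least integer $t \ge 1$ such that for every $k \ge 2$ and every coloring $\chi : \mathrm{Emb}(n, C) \to k$ there is an embedding $w : C \hookrightarrow C$ with $|\chi(w \circ \mathrm{Emb}(n, C))| \le t$; if there is no such $t$, then $T(n, C) = \infty$. The big Ramsey spectrum of $C$ is $\mathrm{spec}(C) = (T(1, C), T(2, C), T(3, C), \ldots)$.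 Theorem. Let $S$ be a countable scattered chain of infinite Hausdorff rank, that is, $r_H(S) \ge \omega$. Then $T(n, S) = \infty$ for every integer $n \ge 2$. Consequently, $\mathrm{spec}(S) = (T(1, S), \infty, \infty, \infty, \ldots)$. -/

import Mathlib

universe u v w

/-- A chain is scattered if the chain of rationals does not embed into it. -/
def IsScattered (S : Type u) [LinearOrder S] : Prop :=
  IsEmpty (ℚ ↪o S)

/-- `HausdorffClass α S`: the chain `S` belongs, up to order-isomorphism, to the class `H_α`, where
`H_0` consists of the empty chain and the one-point chain, and for `α > 0` the class `H_α` consists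
of the sums `∑_{i ∈ ℤ} S_i` (lexicographic order on the disjoint union) in which every `S_i` belongs
to some `H_β` with `β < α`. -/
inductive HausdorffClass : Ordinal.{0} → (S : Type u) → [LinearOrder S] → Prop
  | zero (S : Type u) [LinearOrder S] (hS : Subsingleton S) : HausdorffClass 0 S
  | sum (α : Ordinal.{0}) (hα : 0 < α) (B : ℤ → Type u) [∀ i, LinearOrder (B i)]
      (β : ℤ → Ordinal.{0}) (hβ : ∀ i, β i < α) (hB : ∀ i, HausdorffClass (β i) (B i))
      (S : Type u) [LinearOrder S] (e : S ≃o Σₗ i, B i) : HausdorffClass α S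

/-- The Hausdorff rank `r_H(S)`: the least ordinal `α` such that `S` belongs to `H_α`.
(By Hausdorff's theorem such an `α`, necessarily countable, exists for every countable scattered
chain; for other chains the value is the irrelevant default `0`.) -/
noncomputable def hausdorffRank (S : Type u) [LinearOrder S] : Ordinal.{0} :=
  sInf {α : Ordinal.{0} | HausdorffClass α S}

/-- The partition relation `C ⟶ (B)^A_{k,t}`: for every colouring `χ : Emb(A, C) → k` there is an
embedding `w : B ↪ C` such that `χ` takes at most `t` values on `w ∘ Emb(A, B)`. -/
def ChainArrow (C : Type u) (B : Type v) (A : Type w) [LinearOrder C] [LinearOrder B]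
    [LinearOrder A] (k t : ℕ) : Prop :=
  ∀ χ : (A ↪o C) → Fin k, ∃ w : B ↪o C,
    (Set.range fun f : A ↪o B => χ (f.trans w)).ncard ≤ t

/-- The big Ramsey degree `T(n, C)` of the `n`-element chain in the chain `C`: the least positive
integer `t` such that `C ⟶ (C)^n_{k,t}` for all `k ≥ 2`, and `∞` if there is no such `t`
(the infimum of the empty set in `ℕ∞` is `⊤`). -/
noncomputable def bigRamseyDegree (n : ℕ) (C : Type u) [LinearOrder C] : ℕ∞ :=
  sInf ((fun t : ℕ => (t : ℕ∞)) ''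
    {t : ℕ | 1 ≤ t ∧ ∀ k : ℕ, 2 ≤ k → ChainArrow C C (Fin n) k t})

/-- The big Ramsey spectrum `spec(C) = (T(1, C), T(2, C), T(3, C), …)`. -/
noncomputable def bigRamseySpectrum (C : Type u) [LinearOrder C] : ℕ+ → ℕ∞ :=
  fun n => bigRamseyDegree n C

/-! Unfolding the nested ℤ-sums, a point of `S` is addressed by the finite list of indices leading
to it. This embeds `S` into the lexicographic order on `List ℤ` with a well-founded tree of
prefixes. `pairColor` drops the common prefix of two addresses, takes partial sums of absolute
values along both tails, and counts how often the two sets of sums alternate.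

Size is measured by `Branches m`. A well-founded set without it has rank at most `2 * m`
(`WellFoundedTree.rankLE_of_not_branches`), so every copy of `S` inside `S`, being again of infinite
rank, has it for all `m`. Under `Branches r`, ever larger entries chosen alternately on two paths
make the sums interleave in exactly `r` blocks (`BranchesAtRoot.exists_blockCount`). Hence every
copy realises every positive colour, and truncating the colour refutes any finite bound. Further
points taken from other branches pass from pairs to `n`-tuples. -/

/-! ### The number of blocks of one finite set of naturals with respect to another -/

/-- The number of blocks into which `A` is cut by `B`. -/
def blockCount (A B : Finset ℕ) : ℕ :=
  (A.image fun x => (B.filter (· < x)).card).card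

theorem blockCount_empty (B : Finset ℕ) : blockCount ∅ B = 0 := by
  simp [blockCount]

/-- Prepending a block of `A` followed by a block of `B` adds a block to `A`. -/
theorem blockCount_union_left {A₁ B₁ A B : Finset ℕ} (hA₁ : A₁.Nonempty) (hB₁ : B₁.Nonempty)
    (h₁ : ∀ a ∈ A₁, ∀ b ∈ B₁, a < b) (h₂ : ∀ b ∈ B₁, ∀ a ∈ A, b < a)
    (h₃ : ∀ b ∈ B₁, ∀ b' ∈ B, b < b') :
    blockCount (A₁ ∪ A) (B₁ ∪ B) = blockCount A B + 1 := by
  obtain ⟨b₀, hb₀⟩ := hB₁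
  have e₁ : (A₁.image fun x => ((B₁ ∪ B).filter (· < x)).card) = {0} := by
    refine Finset.eq_singleton_iff_nonempty_unique_mem.2 ⟨hA₁.image _, ?_⟩
    intro y hy
    obtain ⟨a, ha, rfl⟩ := Finset.mem_image.1 hy
    rw [Finset.card_eq_zero, Finset.filter_eq_empty_iff]
    intro b hb
    rcases Finset.mem_union.1 hb with hb | hb
    · exact (h₁ a ha b hb).le.not_gt
    · exact ((h₁ a ha b₀ hb₀).trans (h₃ b₀ hb₀ b hb)).le.not_gt
  have hdisj : Disjoint B₁ B :=
    Finset.disjoint_left.2 fun b hb hb' => lt_irrefl _ (h₃ b hb b hb')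
  have e₂ : (A.image fun x => ((B₁ ∪ B).filter (· < x)).card) =
      (A.image fun x => (B.filter (· < x)).card).image (B₁.card + ·) := by
    rw [Finset.image_image]
    refine Finset.image_congr fun a ha => ?_
    have : B₁.filter (· < a) = B₁ := Finset.filter_eq_self.2 fun b hb => h₂ b hb a ha
    simp only [Function.comp]
    rw [Finset.filter_union, this, Finset.card_union_of_disjoint]
    exact hdisj.mono_right (Finset.filter_subset _ _)
  have hpos : 0 < B₁.card := Finset.card_pos.2 ⟨b₀, hb₀⟩
  unfold blockCount
  rw [Finset.image_union, e₁, e₂, Finset.card_union_of_disjoint,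
    Finset.card_image_of_injective _ (add_right_injective _), Finset.card_singleton, add_comm]
  rw [Finset.disjoint_singleton_left]
  intro h
  obtain ⟨x, -, hx⟩ := Finset.mem_image.1 h
  omega

/-- Prepending a block of `A` followed by a block of `B` adds a block to `B`, if `B` does not start
before `A`. -/
theorem blockCount_union_right {A₁ B₁ A B : Finset ℕ} (hB₁ : B₁.Nonempty)
    (h₁ : ∀ a ∈ A₁, ∀ b ∈ B₁, a < b) (h₂ : ∀ b ∈ B₁, ∀ a ∈ A, b < a)
    (h₃ : ∀ b ∈ B₁, ∀ b' ∈ B, b < b') (h₄ : ∀ b ∈ B, ∃ a ∈ A, a < b) :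
    blockCount (B₁ ∪ B) (A₁ ∪ A) = blockCount B A + 1 := by
  obtain ⟨b₀, hb₀⟩ := hB₁
  have e₁ : (B₁.image fun x => ((A₁ ∪ A).filter (· < x)).card) = {A₁.card} := by
    refine Finset.eq_singleton_iff_nonempty_unique_mem.2 ⟨⟨_, Finset.mem_image_of_mem _ hb₀⟩, ?_⟩
    intro y hy
    obtain ⟨b, hb, rfl⟩ := Finset.mem_image.1 hy
    congr 1
    ext a
    simp only [Finset.mem_filter, Finset.mem_union]
    constructor
    · rintro ⟨ha | ha, hab⟩
      · exact ha
      · exact absurd hab (h₂ b hb a ha).le.not_gt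
    · exact fun ha => ⟨Or.inl ha, h₁ a ha b hb⟩
  have hdisj : Disjoint A₁ A :=
    Finset.disjoint_left.2 fun a ha ha' => lt_asymm (h₁ a ha b₀ hb₀) (h₂ b₀ hb₀ a ha')
  have e₂ : (B.image fun x => ((A₁ ∪ A).filter (· < x)).card) =
      (B.image fun x => (A.filter (· < x)).card).image (A₁.card + ·) := by
    rw [Finset.image_image]
    refine Finset.image_congr fun b hb => ?_
    have : A₁.filter (· < b) = A₁ :=
      Finset.filter_eq_self.2 fun a ha => (h₁ a ha b₀ hb₀).trans (h₃ b₀ hb₀ b hb)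
    simp only [Function.comp]
    rw [Finset.filter_union, this, Finset.card_union_of_disjoint]
    exact hdisj.mono_right (Finset.filter_subset _ _)
  unfold blockCount
  rw [Finset.image_union, e₁, e₂, Finset.card_union_of_disjoint,
    Finset.card_image_of_injective _ (add_right_injective _), Finset.card_singleton, add_comm]
  rw [Finset.disjoint_singleton_left]
  intro h
  obtain ⟨x, hx, hx'⟩ := Finset.mem_image.1 h
  obtain ⟨b, hb, rfl⟩ := Finset.mem_image.1 hx
  obtain ⟨a, ha, hab⟩ := h₄ b hb
  have : 0 < (A.filter (· < b)).card := Finset.card_pos.2 ⟨a, Finset.mem_filter.2 ⟨ha, hab⟩⟩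
  omega

/-! ### Colouring pairs of integer sequences -/

/-- The partial sums, shifted by `c`, of the absolute values of the entries of a list. -/
def partialSums : ℕ → List ℤ → Finset ℕ
  | _, [] => ∅
  | c, i :: l => insert (c + i.natAbs) (partialSums (c + i.natAbs) l)

/-- The offset `d` is the running total after `l`; what matters is that it does not depend on `l'`.
-/
theorem exists_partialSums_append (c : ℕ) (l : List ℤ) :
    ∃ d, ∀ l', partialSums c (l ++ l') = partialSums c l ∪ partialSums d l' := by
  induction l generalizing c with
  | nil => exact ⟨c, fun l' => by simp [partialSums]⟩
  | cons i l ih =>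
    obtain ⟨d, hd⟩ := ih (c + i.natAbs)
    exact ⟨d, fun l' => by simp [partialSums, hd]⟩

theorem le_of_mem_partialSums {c x : ℕ} {l : List ℤ} (h : x ∈ partialSums c l) : c ≤ x := by
  induction l generalizing c with
  | nil => simp [partialSums] at h
  | cons i l ih =>
    rcases Finset.mem_insert.1 h with rfl | h
    · omega
    · have := ih h
      omega

theorem natAbs_le_of_mem_partialSums {c x : ℕ} {i : ℤ} {l : List ℤ}
    (h : x ∈ partialSums c (i :: l)) : c + i.natAbs ≤ x := by
  rcases Finset.mem_insert.1 h with rfl | h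
  · exact le_rfl
  · exact le_of_mem_partialSums h

/-- Removal of the longest common prefix. -/
def dropCommonPrefix : List ℤ → List ℤ → List ℤ × List ℤ
  | i :: a, j :: b => if i = j then dropCommonPrefix a b else (i :: a, j :: b)
  | [], b => ([], b)
  | a, [] => (a, [])

theorem dropCommonPrefix_append (l a b : List ℤ) :
    dropCommonPrefix (l ++ a) (l ++ b) = dropCommonPrefix a b := by
  induction l with
  | nil => rfl
  | cons i l ih => simp [dropCommonPrefix, ih]

/-- The number of blocks into which the partial sums of `a` are cut by those of `b`, after removal
of the common prefix of `a` and `b`. -/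
def pairColor (a b : List ℤ) : ℕ :=
  blockCount (partialSums 0 (dropCommonPrefix a b).1) (partialSums 0 (dropCommonPrefix a b).2)

theorem pairColor_append (l a b : List ℤ) : pairColor (l ++ a) (l ++ b) = pairColor a b := by
  simp [pairColor, dropCommonPrefix_append]

/-! ### Large sets of integer sequences -/

/-- `BranchesAtRoot m X`: the tree of initial segments of elements of `X` contains a copy of the
infinitely branching tree of height `m` that branches immediately at the root. -/
def BranchesAtRoot : ℕ → Set (List ℤ) → Prop
  | 0, X => [] ∈ X
  | m + 1, X => {i : ℤ | ∃ σ, BranchesAtRoot m {l | i :: (σ ++ l) ∈ X}}.Infinite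

/-- The tree of initial segments of elements of `X` contains a copy of the infinitely branching
tree of height `m`. -/
def Branches (m : ℕ) (X : Set (List ℤ)) : Prop :=
  ∃ σ, BranchesAtRoot m {l | σ ++ l ∈ X}

theorem exists_natAbs_gt {I : Set ℤ} (hI : I.Infinite) (N : ℕ) : ∃ i ∈ I, N < i.natAbs := by
  by_contra! h
  refine hI ((Set.finite_Icc (-(N : ℤ)) N).subset fun i hi => ?_)
  have := h i hi
  exact ⟨by omega, by omega⟩

/-- Infinite branching supplies an entry beyond all sums used so far, alternately for `X` and for
`Y`, and each round adds one block on both sides. The bound `N` and the offsets serve the recursion.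
The clause that every sum of `y` exceeds some sum of `x` keeps the next block of `y` from merging
with the current one. -/
theorem BranchesAtRoot.exists_blockCount {r : ℕ} {X Y : Set (List ℤ)} (hX : BranchesAtRoot r X)
    (hY : BranchesAtRoot r Y) (c d N : ℕ) :
    ∃ x ∈ X, ∃ y ∈ Y, (∀ a ∈ partialSums c x, N < a) ∧ (∀ b ∈ partialSums d y, N < b) ∧
      (∀ b ∈ partialSums d y, ∃ a ∈ partialSums c x, a < b) ∧
      blockCount (partialSums c x) (partialSums d y) = r ∧
      blockCount (partialSums d y) (partialSums c x) = r := by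
  induction r generalizing X Y c d N with
  | zero => exact ⟨[], hX, [], hY, by simp [partialSums, blockCount_empty]⟩
  | succ r ih =>
    obtain ⟨i, ⟨σ, hσ⟩, hi⟩ := exists_natAbs_gt hX N
    obtain ⟨c', hc'⟩ := exists_partialSums_append c (i :: σ)
    set A₁ := partialSums c (i :: σ) with hA₁
    obtain ⟨j, ⟨τ, hτ⟩, hj⟩ := exists_natAbs_gt hY (max N (A₁.sup id))
    obtain ⟨d', hd'⟩ := exists_partialSums_append d (j :: τ)
    set B₁ := partialSums d (j :: τ) with hB₁
    obtain ⟨x, hx, y, hy, h₁, h₂, h₃, h₄, h₅⟩ := ih hσ hτ c' d' (max N (B₁.sup id))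
    have hA₁n : A₁.Nonempty := ⟨_, Finset.mem_insert_self _ _⟩
    have hB₁n : B₁.Nonempty := ⟨_, Finset.mem_insert_self _ _⟩
    have hNA : ∀ a ∈ A₁, N < a := fun a ha => by
      have := natAbs_le_of_mem_partialSums ha
      omega
    have hAB : ∀ a ∈ A₁, ∀ b ∈ B₁, a < b := fun a ha b hb => by
      have := natAbs_le_of_mem_partialSums hb
      have := Finset.le_sup (f := id) ha
      simp only [id, max_lt_iff] at *
      omega
    have hNB : ∀ b ∈ B₁, N < b := fun b hb => by
      obtain ⟨a, ha⟩ := hA₁n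
      exact (hNA a ha).trans (hAB a ha b hb)
    have hBA : ∀ b ∈ B₁, ∀ a ∈ partialSums c' x, b < a := fun b hb a ha =>
      ((Finset.le_sup (f := id) hb).trans (le_max_right _ _)).trans_lt (h₁ a ha)
    have hBB : ∀ b ∈ B₁, ∀ b' ∈ partialSums d' y, b < b' := fun b hb b' hb' =>
      ((Finset.le_sup (f := id) hb).trans (le_max_right _ _)).trans_lt (h₂ b' hb')
    refine ⟨i :: (σ ++ x), hx, j :: (τ ++ y), hy, ?_⟩
    rw [← List.cons_append, ← List.cons_append, hc', hd',
      blockCount_union_left hA₁n hB₁n hAB hBA hBB, blockCount_union_right hB₁n hAB hBA hBB h₃,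
      h₄, h₅]
    refine ⟨?_, ?_, ?_, rfl, rfl⟩
    · intro a ha
      rcases Finset.mem_union.1 ha with ha | ha
      · exact hNA a ha
      · exact (le_max_left _ _).trans_lt (h₁ a ha)
    · intro b hb
      rcases Finset.mem_union.1 hb with hb | hb
      · exact hNB b hb
      · exact (le_max_left _ _).trans_lt (h₂ b hb)
    · intro b hb
      rcases Finset.mem_union.1 hb with hb | hb
      · obtain ⟨a, ha⟩ := hA₁n
        exact ⟨a, Finset.mem_union_left _ ha, hAB a ha b hb⟩
      · obtain ⟨a, ha, hab⟩ := h₃ b hb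
        exact ⟨a, Finset.mem_union_right _ ha, hab⟩

theorem Branches.exists_pairColor {r : ℕ} (hr : r ≠ 0) {X : Set (List ℤ)} (hX : Branches r X) :
    ∃ a ∈ X, ∃ b ∈ X, a < b ∧ pairColor a b = r := by
  obtain ⟨σ, hσ⟩ := hX
  obtain ⟨x, hx, y, hy, -, -, h, h₁, h₂⟩ := hσ.exists_blockCount hσ 0 0 0
  -- The first entries differ, so `σ` is the whole common prefix: otherwise the least sum of `y`
  -- would exceed no sum of `x`.
  have key : ∃ i x' j y', x = i :: x' ∧ y = j :: y' ∧ i ≠ j := by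
    match x, y with
    | [], _ => exact absurd h₁.symm (by simpa [partialSums, blockCount_empty] using hr)
    | _, [] => exact absurd h₂.symm (by simpa [partialSums, blockCount_empty] using hr)
    | i :: x', j :: y' =>
      refine ⟨i, x', j, y', rfl, rfl, ?_⟩
      rintro rfl
      obtain ⟨a, ha, hab⟩ := h _ (Finset.mem_insert_self _ _)
      exact absurd hab (natAbs_le_of_mem_partialSums ha).not_gt
  obtain ⟨i, x', j, y', rfl, rfl, hij⟩ := key
  have e₁ : pairColor (σ ++ i :: x') (σ ++ j :: y') = r := by
    rw [pairColor_append]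
    simpa [pairColor, dropCommonPrefix, hij] using h₁
  have e₂ : pairColor (σ ++ j :: y') (σ ++ i :: x') = r := by
    rw [pairColor_append]
    simpa [pairColor, dropCommonPrefix, hij.symm] using h₂
  have hne : σ ++ i :: x' ≠ σ ++ j :: y' := fun he =>
    hij (List.cons.inj (List.append_cancel_left he)).1
  -- Both block counts are `r`, so it does not matter which list is smaller.
  rcases lt_or_gt_of_ne hne with hlt | hlt
  · exact ⟨_, hx, _, hy, hlt, e₁⟩
  · exact ⟨_, hy, _, hx, hlt, e₂⟩

theorem append_lt_append_left {l a b : List ℤ} (h : a < b) : l ++ a < l ++ b := by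
  induction l with
  | nil => exact h
  | cons i l ih => exact List.cons_lt_cons_iff.2 (Or.inr ⟨rfl, ih⟩)

/-- The extra level of branching gives `n + 1` entries `u 0 < u 1 < ⋯`. The coloured pair lies in
the branch of `u 0`, and each later branch contributes one further point. -/
theorem Branches.exists_orderEmbedding {r : ℕ} (hr : r ≠ 0) (n : ℕ) {X : Set (List ℤ)}
    (hX : Branches (r + 1) X) :
    ∃ g : Fin (n + 2) ↪o List ℤ, (∀ k, g k ∈ X) ∧ pairColor (g 0) (g 1) = r := by
  obtain ⟨ρ, hρ⟩ := hX
  have key : ∀ i ∈ {i : ℤ | ∃ σ, BranchesAtRoot r {l | i :: (σ ++ l) ∈ {l | ρ ++ l ∈ X}}},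
      ∃ a b : List ℤ, ρ ++ i :: a ∈ X ∧ ρ ++ i :: b ∈ X ∧ a < b ∧ pairColor a b = r := by
    rintro i hi
    obtain ⟨a, ha, b, hb, hab, hc⟩ := Branches.exists_pairColor hr (X := {l | ρ ++ i :: l ∈ X}) hi
    exact ⟨a, b, ha, hb, hab, hc⟩
  choose! a b ha hb hab hc using key
  obtain ⟨F, hFI, hF⟩ := Set.Infinite.exists_subset_card_eq hρ (n + 1)
  set u := F.orderEmbOfFin hF
  have hu : ∀ k, u k ∈ {i : ℤ | ∃ σ, BranchesAtRoot r {l | i :: (σ ++ l) ∈ {l | ρ ++ l ∈ X}}} :=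
    fun k => hFI (F.orderEmbOfFin_mem hF k)
  have hmono : StrictMono fun k => ρ ++ u k :: b (u k) := fun k l hkl =>
    append_lt_append_left (List.cons_lt_cons_iff.2 (Or.inl (u.strictMono hkl)))
  have hlt : ρ ++ u 0 :: a (u 0) < ρ ++ u 0 :: b (u 0) :=
    append_lt_append_left (List.cons_lt_cons_iff.2 (Or.inr ⟨rfl, hab _ (hu 0)⟩))
  refine ⟨OrderEmbedding.ofStrictMono _ (hmono.vecCons hlt), fun k => ?_, ?_⟩
  · refine Fin.cases ?_ (fun k => ?_) k
    · exact ha _ (hu 0)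
    · exact hb _ (hu k)
  · have : pairColor (ρ ++ u 0 :: a (u 0)) (ρ ++ u 0 :: b (u 0)) = r := by
      rw [pairColor_append]
      have := pairColor_append [u 0] (a (u 0)) (b (u 0))
      exact this.trans (hc _ (hu 0))
    exact this

/-! ### Hausdorff classes -/

theorem HausdorffClass.of_fibers {α : Ordinal.{0}} (hα : 0 < α) {S : Type u} [LinearOrder S]
    {f : S → ℤ} (hf : Monotone f) (β : ℤ → Ordinal.{0}) (hβ : ∀ i, β i < α)
    (h : ∀ i, HausdorffClass (β i) {s // f s = i}) : HausdorffClass α S := by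
  let F : S → Σₗ i, {s // f s = i} := fun x => toLex ⟨f x, ⟨x, rfl⟩⟩
  have hF : StrictMono F := by
    intro x y hxy
    rcases (hf hxy.le).lt_or_eq with h | h
    · exact Sigma.Lex.lt_def.2 (Or.inl h)
    · refine Sigma.Lex.lt_def.2 (Or.inr ⟨h, ?_⟩)
      -- With the index equation generalised it can be substituted, and the transport vanishes.
      have key : ∀ (i j : ℤ) (hij : i = j) (a : {s // f s = i}) (b : {s // f s = j}),
          (a : S) < b → hij ▸ a < b := by
        rintro i _ rfl a b hab
        exact hab
      exact key _ _ h _ _ hxy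
  have hF' : Function.Surjective F := by
    rintro ⟨i, x, rfl⟩
    exact ⟨x, rfl⟩
  exact .sum α hα _ β hβ h S (hF.orderIsoOfSurjective F hF')

/-- The summands are rebuilt as fibres inside `S`, which may live in another universe than `A`. -/
theorem HausdorffClass.of_orderIso {α : Ordinal.{0}} {A : Type v} [LinearOrder A]
    (h : HausdorffClass α A) : ∀ (S : Type u) [LinearOrder S], S ≃o A → HausdorffClass α S := by
  induction h with
  | zero A hA => exact fun S _ e => .zero S e.injective.subsingleton
  | sum α hα B β hβ hB A e ih =>
    intro S _ f
    let g := f.trans e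
    have hg : Monotone fun s => (ofLex (g s)).1 := fun s t hst => by
      rcases Sigma.Lex.le_def.1 (g.monotone hst) with h | ⟨h, -⟩
      · exact h.le
      · exact h.le
    refine .of_fibers hα hg β hβ fun i => ih i _ ?_
    let F : B i → {s // (ofLex (g s)).1 = i} := fun x =>
      ⟨g.symm (toLex ⟨i, x⟩), by rw [g.apply_symm_apply]; rfl⟩
    have hF : StrictMono F := fun x y hxy =>
      g.symm.strictMono (Sigma.Lex.lt_def.2 (Or.inr ⟨rfl, hxy⟩))
    have hF' : Function.Surjective F := by
      rintro ⟨s, rfl⟩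
      exact ⟨(ofLex (g s)).2, Subtype.ext (g.symm_apply_apply s)⟩
    exact (hF.orderIsoOfSurjective F hF').symm

/-- The chain `S` belongs to `H_β` for some `β ≤ k`. -/
def RankLE (k : ℕ) (S : Type u) [LinearOrder S] : Prop :=
  ∃ β : Ordinal.{0}, β ≤ k ∧ HausdorffClass β S

theorem RankLE.of_orderIso {k : ℕ} {A : Type v} [LinearOrder A] (h : RankLE k A) {S : Type u}
    [LinearOrder S] (e : S ≃o A) : RankLE k S :=
  let ⟨β, hβ, hA⟩ := h
  ⟨β, hβ, hA.of_orderIso S e⟩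

theorem RankLE.of_subsingleton (k : ℕ) (S : Type u) [LinearOrder S] [Subsingleton S] :
    RankLE k S :=
  ⟨0, zero_le, .zero S inferInstance⟩

theorem RankLE.of_fibers {k : ℕ} {L : Type u} [LinearOrder L] {X : Set L} {f : L → ℤ}
    (hf : MonotoneOn f X) (h : ∀ i, RankLE k ↥(X ∩ f ⁻¹' {i})) : RankLE (k + 1) X := by
  choose β hβ hX using h
  refine ⟨(k + 1 : ℕ), le_rfl, .of_fibers (by simp) (f := fun x : X => f x)
    (fun x y hxy => hf x.2 y.2 hxy) β (fun i => (hβ i).trans_lt ?_) fun i => ?_⟩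
  · exact_mod_cast Nat.lt_succ_self k
  · let F : {x : X // f x = i} → ↥(X ∩ f ⁻¹' {i}) := fun x => ⟨x.1, x.1.2, x.2⟩
    have hF : StrictMono F := fun x y hxy => hxy
    have hF' : Function.Surjective F := fun x => ⟨⟨⟨x, x.2.1⟩, x.2.2⟩, rfl⟩
    exact (hX i).of_orderIso _ (hF.orderIsoOfSurjective F hF')

/-- `X` is a finite sum of chains of rank at most `k`. -/
inductive FinSum (k : ℕ) {L : Type u} [LinearOrder L] : Set L → Prop
  | base (X : Set L) (hX : RankLE k X) : FinSum k X
  | union (A B : Set L) (hA : FinSum k A) (hB : FinSum k B) (h : ∀ a ∈ A, ∀ b ∈ B, a < b) :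
      FinSum k (A ∪ B)

theorem FinSum.image {k : ℕ} {L : Type u} [LinearOrder L] {M : Type v} [LinearOrder M]
    (f : L ↪o M) {X : Set L} (hX : FinSum k X) : FinSum k (f '' X) := by
  induction hX with
  | base X hX =>
    refine .base _ (hX.of_orderIso (StrictMonoOn.orderIso f X (f.strictMono.strictMonoOn X)).symm)
  | union A B hA hB h ihA ihB =>
    rw [Set.image_union]
    refine .union _ _ ihA ihB ?_
    rintro _ ⟨a, ha, rfl⟩ _ ⟨b, hb, rfl⟩
    exact f.strictMono (h a ha b hb)

/-- The bound `N` lets the labels of an upper summand be shifted past those of a lower one. -/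
theorem FinSum.exists_monotoneOn {k : ℕ} {L : Type u} [LinearOrder L] {X : Set L}
    (hX : FinSum k X) : ∃ f : L → ℤ, MonotoneOn f X ∧ (∃ N, ∀ x ∈ X, 0 ≤ f x ∧ f x < N) ∧
      ∀ i, RankLE k ↥(X ∩ f ⁻¹' {i}) := by
  induction hX with
  | base X hX =>
    refine ⟨fun _ => 0, fun _ _ _ _ _ => le_rfl, ⟨1, by simp⟩, fun i => ?_⟩
    by_cases hi : i = 0
    · subst hi
      have : X ∩ (fun _ => (0 : ℤ)) ⁻¹' {0} = X := by
        ext x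
        simp
      rwa [this]
    · have : X ∩ (fun _ => (0 : ℤ)) ⁻¹' {i} = ∅ := by
        ext x
        simp [Ne.symm hi]
      rw [this]
      exact .of_subsingleton _ _
  | union A B hA hB h ihA ihB =>
    classical
    obtain ⟨f, hf, ⟨N, hN⟩, hfk⟩ := ihA
    obtain ⟨g, hg, ⟨M, hM⟩, hgk⟩ := ihB
    have hBA : ∀ b ∈ B, b ∉ A := fun b hb ha => lt_irrefl _ (h b ha b hb)
    let F : L → ℤ := fun x => if x ∈ A then f x else max N 0 + g x
    have hFA : ∀ a ∈ A, F a = f a := fun a ha => if_pos ha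
    have hFB : ∀ b ∈ B, F b = max N 0 + g b := fun b hb => if_neg (hBA b hb)
    refine ⟨F, ?_, ⟨max N 0 + max M 0, ?_⟩, fun i => ?_⟩
    · rintro x (hx | hx) y (hy | hy) hxy
      · rw [hFA x hx, hFA y hy]
        exact hf hx hy hxy
      · rw [hFA x hx, hFB y hy]
        have := hN x hx
        have := hM y hy
        omega
      · exact absurd hxy (h y hy x hx).not_ge
      · rw [hFB x hx, hFB y hy]
        have := hg hx hy hxy
        omega
    · rintro x (hx | hx)
      · rw [hFA x hx]
        have := hN x hx
        omega
      · rw [hFB x hx]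
        have := hM x hx
        omega
    · by_cases hi : i < max N 0
      · have : (A ∪ B) ∩ F ⁻¹' {i} = A ∩ f ⁻¹' {i} := by
          ext x
          constructor
          · rintro ⟨hx | hx, hxi⟩
            · exact ⟨hx, (hFA x hx).symm.trans hxi⟩
            · have h₁ := (hFB x hx).symm.trans hxi
              have := hM x hx
              omega
          · exact fun ⟨hx, hxi⟩ => ⟨Or.inl hx, (hFA x hx).trans hxi⟩
        rw [this]
        exact hfk i
      · have : (A ∪ B) ∩ F ⁻¹' {i} = B ∩ g ⁻¹' {i - max N 0} := by
          ext x
          constructor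
          · rintro ⟨hx | hx, hxi⟩
            · have h₁ := (hFA x hx).symm.trans hxi
              have := hN x hx
              omega
            · have h₁ : max N 0 + g x = i := (hFB x hx).symm.trans hxi
              exact ⟨hx, show g x = _ by omega⟩
          · rintro ⟨hx, hxi⟩
            have hxi : g x = i - max N 0 := hxi
            exact ⟨Or.inr hx, (hFB x hx).trans (by omega)⟩
        rw [this]
        exact hgk _

theorem FinSum.rankLE {k : ℕ} {L : Type u} [LinearOrder L] {X : Set L} (hX : FinSum k X) :
    RankLE (k + 1) X :=
  let ⟨_, hf, _, h⟩ := hX.exists_monotoneOn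
  .of_fibers hf h

/-! ### Well-founded sets of integer sequences -/

/-- The tree of initial segments of elements of `X` is well-founded. -/
inductive WellFoundedTree : Set (List ℤ) → Prop
  | empty : WellFoundedTree ∅
  | node (X : Set (List ℤ)) (h : ∀ i : ℤ, WellFoundedTree {l | i :: l ∈ X}) : WellFoundedTree X

theorem WellFoundedTree.mono {X Y : Set (List ℤ)} (hX : WellFoundedTree X) (hYX : Y ⊆ X) :
    WellFoundedTree Y := by
  induction hX generalizing Y with
  | empty => exact Set.subset_empty_iff.1 hYX ▸ .empty
  | node X h ih => exact .node _ fun i => ih i fun l hl => hYX hl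

/-- Each sum prepends its index to the addresses within the summand. -/
theorem HausdorffClass.exists_orderEmbedding {α : Ordinal.{0}} {S : Type u} [LinearOrder S]
    (h : HausdorffClass α S) : ∃ p : S ↪o List ℤ, WellFoundedTree (Set.range p) := by
  induction h with
  | zero S hS =>
    refine ⟨OrderEmbedding.ofStrictMono (fun _ => []) fun x y h =>
      absurd (Subsingleton.elim x y) h.ne, .node _ fun i => ?_⟩
    have : {l | i :: l ∈ Set.range fun _ : S => ([] : List ℤ)} = ∅ := by
      ext l
      simp
    exact this ▸ .empty
  | sum α hα B β hβ hB S e ih =>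
    choose p hp using ih
    let q : (Σₗ i, B i) → List ℤ := fun x => (ofLex x).1 :: p _ (ofLex x).2
    have hq : StrictMono q := by
      rintro ⟨i, x⟩ ⟨j, y⟩ h
      rcases Sigma.Lex.lt_def.1 h with h | ⟨h, h'⟩
      · exact List.cons_lt_cons_iff.2 (Or.inl h)
      · change i = j at h
        subst h
        exact List.cons_lt_cons_iff.2 (Or.inr ⟨rfl, (p i).strictMono h'⟩)
    refine ⟨e.toOrderEmbedding.trans (OrderEmbedding.ofStrictMono q hq), .node _ fun i => ?_⟩
    refine (hp i).mono ?_
    rintro l ⟨s, hs⟩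
    obtain ⟨⟨j, x⟩, hx⟩ : ∃ x, e s = x := ⟨_, rfl⟩
    have hs' : q (e s) = i :: l := hs
    rw [hx] at hs'
    obtain ⟨rfl, rfl⟩ := List.cons.inj hs'
    exact ⟨x, rfl⟩

/-- Prepending an entry to a list. -/
def consEmbedding (i : ℤ) : List ℤ ↪o List ℤ :=
  OrderEmbedding.ofStrictMono (List.cons i) fun _ _ h => List.cons_lt_cons_iff.2 (Or.inr ⟨rfl, h⟩)

/-- The finitely many exceptional first entries in `F` cut the remaining ones into finitely many
intervals, each giving a single ℤ-sum of chains of rank at most `k`. The set `I` varies so that the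
induction can restrict to either side of an entry. -/
theorem finSum_setOf_cons {k : ℕ} {X : Set (List ℤ)} (F : Finset ℤ)
    (hF : ∀ i ∈ F, FinSum (k + 1) {l | i :: l ∈ X}) (I : Set ℤ)
    (hI : ∀ i ∈ I, i ∉ F → RankLE k ↥{l | i :: l ∈ X}) :
    FinSum (k + 1) {x ∈ X | ∃ i ∈ I, ∃ l, x = i :: l} := by
  induction hn : F.card generalizing F I with
  | zero =>
    rw [Finset.card_eq_zero] at hn
    subst hn
    refine .base _ (RankLE.of_fibers (f := fun x => x.headD 0) ?_ fun i => ?_)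
    · rintro _ ⟨-, i, -, l, rfl⟩ _ ⟨-, j, -, m, rfl⟩ h
      rcases h.lt_or_eq with h | h
      · rcases List.cons_lt_cons_iff.1 h with h | h
        · exact h.le
        · exact h.1.le
      · exact (List.cons.inj h).1.le
    · by_cases hi : i ∈ I
      · have : {x ∈ X | ∃ i ∈ I, ∃ l, x = i :: l} ∩ (fun x => x.headD 0) ⁻¹' {i} =
            consEmbedding i '' {l | i :: l ∈ X} := by
          ext x
          constructor
          · rintro ⟨⟨hx, j, -, l, rfl⟩, rfl⟩
            exact ⟨l, hx, rfl⟩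
          · rintro ⟨l, hl, rfl⟩
            exact ⟨⟨hl, i, hi, l, rfl⟩, rfl⟩
        rw [this]
        exact (hI i hi (by simp)).of_orderIso
          (StrictMonoOn.orderIso _ _ ((consEmbedding i).strictMono.strictMonoOn _)).symm
      · have : {x ∈ X | ∃ i ∈ I, ∃ l, x = i :: l} ∩ (fun x => x.headD 0) ⁻¹' {i} = ∅ := by
          rw [Set.eq_empty_iff_forall_notMem]
          rintro x ⟨⟨hx, j, hj, l, rfl⟩, rfl⟩
          exact hi hj
        rw [this]
        exact .of_subsingleton _ _
  | succ n ih =>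
    obtain ⟨i, hi⟩ : F.Nonempty := Finset.card_pos.1 (by omega)
    have hcard : (F.erase i).card = n := by rw [Finset.card_erase_of_mem hi, hn]; rfl
    have h₁ := ih (F.erase i) (fun j hj => hF j (Finset.mem_of_mem_erase hj)) (I ∩ Set.Iio i)
      (fun j hj hjF => hI j hj.1 fun h => hjF (Finset.mem_erase.2 ⟨(hj.2 : j < i).ne, h⟩)) hcard
    have h₂ := ih (F.erase i) (fun j hj => hF j (Finset.mem_of_mem_erase hj)) (I ∩ Set.Ioi i)
      (fun j hj hjF => hI j hj.1 fun h => hjF (Finset.mem_erase.2 ⟨(hj.2 : i < j).ne', h⟩)) hcard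
    have h₀ : FinSum (k + 1) {x ∈ X | i ∈ I ∧ ∃ l, x = i :: l} := by
      by_cases hiI : i ∈ I
      · convert (hF i hi).image (consEmbedding i) using 1
        ext x
        constructor
        · rintro ⟨hx, -, l, rfl⟩
          exact ⟨l, hx, rfl⟩
        · rintro ⟨l, hl, rfl⟩
          exact ⟨hl, hiI, l, rfl⟩
      · simp only [hiI, false_and, and_false, Set.ofPred_false]
        exact .base _ (.of_subsingleton _ _)
    convert (h₁.union _ _ h₀ ?_).union _ _ h₂ ?_ using 1
    · ext x
      constructor
      · rintro ⟨hx, j, hj, l, rfl⟩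
        rcases lt_trichotomy j i with h | rfl | h
        · exact Or.inl (Or.inl ⟨hx, j, ⟨hj, h⟩, l, rfl⟩)
        · exact Or.inl (Or.inr ⟨hx, hj, l, rfl⟩)
        · exact Or.inr ⟨hx, j, ⟨hj, h⟩, l, rfl⟩
      · rintro ((⟨hx, j, hj, l, rfl⟩ | ⟨hx, hj, l, rfl⟩) | ⟨hx, j, hj, l, rfl⟩)
        · exact ⟨hx, j, hj.1, l, rfl⟩
        · exact ⟨hx, i, hj, l, rfl⟩
        · exact ⟨hx, j, hj.1, l, rfl⟩
    · rintro _ ⟨-, j, hj, l, rfl⟩ _ ⟨-, -, m, rfl⟩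
      exact List.cons_lt_cons_iff.2 (Or.inl hj.2)
    · rintro _ (⟨-, j, hj, l, rfl⟩ | ⟨-, -, l, rfl⟩) _ ⟨-, j', hj', m, rfl⟩
      · exact List.cons_lt_cons_iff.2 (Or.inl (lt_trans hj.2 hj'.2))
      · exact List.cons_lt_cons_iff.2 (Or.inl hj'.2)

theorem Branches.of_cons {m : ℕ} {X : Set (List ℤ)} {i : ℤ} (h : Branches m {l | i :: l ∈ X}) :
    Branches m X :=
  let ⟨σ, hσ⟩ := h
  ⟨i :: σ, hσ⟩

/-- Only finitely many first entries lead to a subtree with `Branches m`. The others have rank at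
most `2 * m` by induction on `m`, and the exceptional ones are handled by induction on the tree. -/
theorem WellFoundedTree.rankLE_of_not_branches {m : ℕ} {X : Set (List ℤ)}
    (hX : WellFoundedTree X) (h : ¬ Branches m X) : RankLE (2 * m) X := by
  induction m generalizing X with
  | zero =>
    have : X = ∅ := Set.eq_empty_iff_forall_notMem.2 fun x hx => h ⟨x, by simpa [BranchesAtRoot]⟩
    subst this
    exact .of_subsingleton _ _
  | succ m ihm =>
    -- Finite sums are closed under concatenation, so descending through exceptional subtrees costs
    -- no rank; one unit is paid here, the other in the ℤ-sums.
    suffices H : FinSum (2 * m + 1) X from H.rankLE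
    induction hX with
    | empty => exact .base _ (.of_subsingleton _ _)
    | node X hX ih =>
      have hfin : {i : ℤ | Branches m {l | i :: l ∈ X}}.Finite := by
        by_contra hinf
        exact h ⟨[], hinf⟩
      have h₁ := finSum_setOf_cons (X := X) hfin.toFinset
        (fun i _ => ih i fun h' => h h'.of_cons) Set.univ
        (fun i _ hi => ihm (hX i) (by simpa using hi))
      have h₀ : FinSum (2 * m + 1) (X ∩ {[]}) := by
        have : Subsingleton ↥(X ∩ {[]}) :=
          Set.subsingleton_coe _ |>.2 (Set.subsingleton_singleton.anti Set.inter_subset_right)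
        exact .base _ (.of_subsingleton _ _)
      convert h₀.union _ _ h₁ ?_ using 1
      · ext x
        cases x <;> simp
      · rintro _ ⟨-, rfl⟩ _ ⟨-, i, -, l, rfl⟩
        exact List.nil_lt_cons i l

/-! ### The big Ramsey degrees of chains of infinite rank -/

theorem branches_range_of_not_rankLE {S : Type u} [LinearOrder S] (hS : ∀ k, ¬ RankLE k S)
    (p : S ↪o List ℤ) (hp : WellFoundedTree (Set.range p)) (m : ℕ) :
    Branches m (Set.range p) := by
  by_contra h
  exact hS _ ((hp.rankLE_of_not_branches h).of_orderIso p.strictMono.orderIso)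

theorem not_chainArrow_of_not_rankLE {S : Type u} [LinearOrder S] (hS : ∀ k, ¬ RankLE k S)
    (p : S ↪o List ℤ) (hp : WellFoundedTree (Set.range p)) (n t : ℕ) :
    ¬ ChainArrow S S (Fin (n + 2)) (t + 2) t := by
  intro h
  -- Truncation at `t + 1` leaves the `t + 1` positive colours, one more than allowed.
  obtain ⟨w, hw⟩ := h fun f =>
    ⟨min (pairColor (p (f 0)) (p (f 1))) (t + 1), by omega⟩
  have hY := branches_range_of_not_rankLE hS (w.trans p)
    (hp.mono (by rintro _ ⟨s, rfl⟩; exact ⟨w s, rfl⟩))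
  have hsub : ((Finset.univ.erase 0 : Finset (Fin (t + 2))) : Set (Fin (t + 2))) ⊆
      Set.range fun f : Fin (n + 2) ↪o S =>
        (⟨min (pairColor (p (f.trans w 0)) (p (f.trans w 1))) (t + 1), by omega⟩ :
          Fin (t + 2)) := by
    intro r hr
    have hr0 : (r : ℕ) ≠ 0 := fun h => by
      simp [Fin.ext_iff, h] at hr
    obtain ⟨g, hg, hgr⟩ := (hY (r + 1)).exists_orderEmbedding hr0 n
    choose s hs using hg
    have hs' : ∀ k, p (w (s k)) = g k := hs
    refine ⟨OrderEmbedding.ofStrictMono s fun i j hij => ?_, ?_⟩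
    · rw [← OrderEmbedding.lt_iff_lt (w.trans p), hs, hs]
      exact g.strictMono hij
    · ext
      change min (pairColor (p (w (s 0))) (p (w (s 1)))) (t + 1) = r
      rw [hs', hs', hgr]
      omega
  have := Set.ncard_le_ncard hsub (Set.toFinite _)
  rw [Set.ncard_coe_finset, Finset.card_erase_of_mem (Finset.mem_univ _), Finset.card_univ,
    Fintype.card_fin] at this
  have := this.trans hw
  omega

theorem mainTheorem1 (S : Type u) [LinearOrder S] [Countable S] (hS : IsScattered S)
    (hrank : Ordinal.omega0 ≤ hausdorffRank S) :
    (∀ n : ℕ, 2 ≤ n → bigRamseyDegree n S = ⊤) ∧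
      bigRamseySpectrum S = fun n : ℕ+ => if n = 1 then bigRamseyDegree 1 S else ⊤ := by
  have hk : ∀ k, ¬ RankLE k S := by
    rintro k ⟨β, hβ, h⟩
    have h₁ : hausdorffRank S ≤ β := csInf_le' h
    exact absurd (hrank.trans (h₁.trans hβ)) (Ordinal.natCast_lt_omega0 k).not_ge
  -- Were `S` in no class, its rank would be the default `0`, which is below `ω`.
  obtain ⟨α, hα⟩ : {α : Ordinal.{0} | HausdorffClass α S}.Nonempty := by
    by_contra hne
    rw [Set.not_nonempty_iff_eq_empty] at hne
    rw [hausdorffRank, hne, Ordinal.sInf_empty] at hrank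
    exact absurd hrank Ordinal.omega0_pos.not_ge
  obtain ⟨p, hp⟩ := hα.exists_orderEmbedding
  have htop : ∀ n : ℕ, 2 ≤ n → bigRamseyDegree n S = ⊤ := by
    intro n hn
    obtain ⟨n, rfl⟩ := Nat.exists_eq_add_of_le' hn
    have : {t : ℕ | 1 ≤ t ∧ ∀ k : ℕ, 2 ≤ k → ChainArrow S S (Fin (n + 2)) k t} = ∅ :=
      Set.eq_empty_iff_forall_notMem.2 fun t ht =>
        not_chainArrow_of_not_rankLE hk p hp n t (ht.2 (t + 2) (by omega))
    rw [bigRamseyDegree, this, Set.image_empty, sInf_empty]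
  refine ⟨htop, funext fun n => ?_⟩
  by_cases hn : n = 1
  · subst hn
    simp [bigRamseySpectrum]
  · have : (n : ℕ) ≠ 1 := fun h => hn (PNat.coe_eq_one_iff.1 h)
    have := n.pos
    simpa [bigRamseySpectrum, hn] using htop n (by omega)
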